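/- Let $\Gamma$ be a finite distance-regular graph of diameter $D\ge 3$ with classical parameters $(D,b,\alpha,\beta)$, i.e. with intersection numbers $b_i=([D]-[i])(\beta-\alpha[i])$ for $0\le i\le D-1$ and $c_i=[i](1+\alpha[i-1])$ for $1\le i\le D$, where $[j]=\frac{b^j-1}{b-1}$ if $b\ne 1$ and $[j]=j$ if $b=1$. Here, for vertices $x,y$ at distance $i$, $c_i$ and $b_i$ are the numbers of neighbours of $y$ at distance $i-1$, respectively $i+1$, from $x$. Assume $b\ge 2$ and $1\le\alpha\le b-1$. A Delsarte clique of $\Gamma$ is a clique with exactly $1+\frac{k}{-\theta_{\min}}$ vertices, where $k=b_0$ is the valency of $\Gamma$ and $\theta_{\min}$ is the smallest eigenvalue of its adjacency matrix. Assume that $\Gamma$ is geometric, i.e. there is a set of Delsarte cliques such that each edge of $\Gamma$ lies in exactly one of them, and let $\mathcal C$ be a set of Delsarte cliques such that $\Gamma$ is the point graph of the partial linear space $(V(\Gamma),\mathcal C,\in)$; that is, any two distinct vertices lie in at most one common member (line) of $\mathcal C$, and they are adjacent if and only if they lie in a common line. Let $r=[D]$. If $\beta>(r-\alpha-1)\alpha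 b+\alpha$, then $\Gamma$ satisfies the dual Pasch axiom: for any two adjacent vertices $x,y$ of $\Gamma$, the set of common neighbours of $x$ and $y$ that are not on the line of $\mathcal C$ through $x$ and $y$ is a clique. -/

import Mathlib

namespace DistReg

/-- The number `[j]` with respect to `b`: `(b ^ j - 1) / (b - 1)` if `b ≠ 1`, and `j` if `b = 1`. -/
noncomputable def bracket (b : ℝ) (j : ℕ) : ℝ :=
  open Classical in if b = 1 then (j : ℝ) else (b ^ j - 1) / (b - 1)

/-- The connected graph `G` has intersection numbers `b_i = B i` and `c_i = C i`
(`0 ≤ i ≤ diameter`): for any two vertices `x, y` at distance `i`, exactly `C i` neighbours of `y`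
are at distance `i - 1` from `x` and exactly `B i` neighbours of `y` are at distance `i + 1`
from `x`. -/
def HasIntersectionNumbers {V : Type*} (G : SimpleGraph V) (B C : ℕ → ℕ) : Prop :=
  G.Connected ∧ ∀ x y : V,
    {z | G.Adj y z ∧ G.dist x z + 1 = G.dist x y}.ncard = C (G.dist x y) ∧
    {z | G.Adj y z ∧ G.dist x z = G.dist x y + 1}.ncard = B (G.dist x y)

/-- Distance-regular graphs (on a finite vertex set, with simple undirected edges). -/
def IsDistanceRegular {V : Type*} (G : SimpleGraph V) : Prop :=
  ∃ B C : ℕ → ℕ, HasIntersectionNumbers G B C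

/-- `G` is a distance-regular graph with classical parameters `(D, b, α, β)`. -/
def HasClassicalParameters {V : Type*} (G : SimpleGraph V) (D : ℕ) (b α β : ℝ) : Prop :=
  G.diam = D ∧ ∃ B C : ℕ → ℕ, HasIntersectionNumbers G B C ∧
    (∀ i : ℕ, i < D →
      (B i : ℝ) = (bracket b D - bracket b i) * (β - α * bracket b i)) ∧
    (∀ i : ℕ, 1 ≤ i → i ≤ D →
      (C i : ℝ) = bracket b i * (1 + α * bracket b (i - 1)))

section Cliques

variable {V : Type*} [Fintype V] [DecidableEq V]

/-- `θ` is the smallest eigenvalue of (the adjacency matrix of) `G`. -/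
def IsSmallestEigenvalue (G : SimpleGraph V) [DecidableRel G.Adj] (θ : ℝ) : Prop :=
  IsLeast {μ : ℝ | Module.End.HasEigenvalue (Matrix.toLin' (G.adjMatrix ℝ)) μ} θ

/-- A Delsarte clique of a regular graph `G` of valency `k` with smallest eigenvalue `θ`:
a clique with exactly `1 + k / (-θ)` vertices. -/
def IsDelsarteClique (G : SimpleGraph V) [DecidableRel G.Adj] (K : Finset V) : Prop :=
  G.IsClique (K : Set V) ∧ ∃ (k : ℕ) (θ : ℝ), G.IsRegularOfDegree k ∧
    IsSmallestEigenvalue G θ ∧ (K.card : ℝ) = 1 + (k : ℝ) / (-θ)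

/-- `G` is a geometric distance-regular graph: there is a set of Delsarte cliques such that each
edge lies in exactly one of them. -/
def IsGeometric (G : SimpleGraph V) [DecidableRel G.Adj] : Prop :=
  IsDistanceRegular G ∧ ∃ 𝓒 : Set (Finset V), (∀ K ∈ 𝓒, IsDelsarteClique G K) ∧
    ∀ x y : V, G.Adj x y → ∃! K : Finset V, K ∈ 𝓒 ∧ x ∈ K ∧ y ∈ K

end Cliques

section PartialLinearSpaces

variable {V : Type*}

/-- `(V, 𝓛, ∈)` is a partial linear space: the sets of points and of lines are non-empty, and any
two distinct points are on at most one common line. -/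
def IsPartialLinearSpace (𝓛 : Set (Finset V)) : Prop :=
  Nonempty V ∧ 𝓛.Nonempty ∧
    ∀ x y : V, x ≠ y → ∀ K ∈ 𝓛, ∀ L ∈ 𝓛, x ∈ K → y ∈ K → x ∈ L → y ∈ L → K = L

/-- The point graph of `(V, 𝓛, ∈)`: two distinct points are adjacent if and only if they are on a
common line. -/
def pointGraph (𝓛 : Set (Finset V)) : SimpleGraph V where
  Adj x y := x ≠ y ∧ ∃ L ∈ 𝓛, x ∈ L ∧ y ∈ L
  symm := ⟨fun _ _ h => ⟨h.1.symm, h.2.imp fun _ hL => ⟨hL.1, hL.2.2, hL.2.1⟩⟩⟩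
  loopless := ⟨fun _ h => h.1 rfl⟩

/-- The dual Pasch axiom for `G`, the point graph of the partial linear space `(V, 𝓛, ∈)`: for any
two adjacent vertices `x, y`, the common neighbours of `x` and `y` that are not on the line through
`x` and `y` form a clique. -/
def DualPasch (G : SimpleGraph V) (𝓛 : Set (Finset V)) : Prop :=
  ∀ x y : V, G.Adj x y → ∀ L ∈ 𝓛, x ∈ L → y ∈ L →
    G.IsClique (G.commonNeighbors x y \ (L : Set V))

end PartialLinearSpaces

end DistReg

/-! The argument turns spectral data into incidence counts and then counts common neighbours.

Put `r = [D]`. The smallest eigenvalue is `-r`, so lines have `1 + β` points and each point is on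
`r` lines. An eigenfunction for `-r` sums to zero on every line. Applied to the function that
depends only on the distance from a vertex `x`, this shows that a line at distance `i < D` from `x`
has exactly `1 + α[i]` points nearest to `x` (`card_nearest`).

Let `z` be at distance one from a line `L`. Call a line through `z` near if all its points are
within distance one of `L`, and far otherwise. For `p ∈ L` at distance two from `z`, exactly `1 + b`
lines through `z` meet the neighbourhood of `p`, and the near lines are among them. The bound on `β`
yields one `p` for which no far line is among them, so there are `1 + b` near lines, and equality
then holds for every such `p`. Hence all points of a far line that have a neighbour on `L` have the
same neighbours on `L` (`neighbors_inter_eq`).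

Now let `x, y ∈ L` be distinct, and let `N` be the set of their common neighbours off `L`, so `|N| =
(r - 1)α`. Each far line through `z ∈ N` carries `α` further points of `N`. If `z, z' ∈ N` were
distinct and non-adjacent, `z'` would have at least `(r - 1 - b)α` neighbours in `N`, and `z` at
least `(r - 2b)α` neighbours in `N` not adjacent to `z'`. This forces `r ≤ 3b`, which is false for
`D ≥ 3`, `b ≥ 2`. -/

namespace DistReg

/-! ### Arithmetic of the numbers `[j]`. -/

section Bracket

variable {b : ℝ}

lemma bracket_zero (hb : b ≠ 1) : bracket b 0 = 0 := by simp [bracket, hb]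

lemma bracket_succ (hb : b ≠ 1) (j : ℕ) : bracket b (j + 1) = 1 + b * bracket b j := by
  have h : b - 1 ≠ 0 := sub_ne_zero.2 hb
  simp only [bracket, hb, if_false]
  field_simp
  ring

lemma bracket_one (hb : b ≠ 1) : bracket b 1 = 1 := by
  simpa [bracket_zero hb] using bracket_succ hb 0

lemma bracket_two (hb : b ≠ 1) : bracket b 2 = 1 + b := by
  simpa [bracket_one hb] using bracket_succ hb 1

lemma bracket_mono (hb : 1 < b) : Monotone (bracket b) := by
  intro i j hij
  have h : 0 < b - 1 := sub_pos.2 hb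
  simp only [bracket, hb.ne', if_false]
  gcongr
  exact hb.le

lemma bracket_nonneg (hb : 1 < b) (j : ℕ) : 0 ≤ bracket b j :=
  (bracket_zero hb.ne').symm.le.trans (bracket_mono hb (Nat.zero_le j))

end Bracket

/-! ### The standard sequence, and sums of radial functions over neighbourhoods. -/

/-- The absolute values of the standard sequence of the eigenvalue `-[D]` of a distance-regular
graph with classical parameters `(D, b, α, β)`. -/
noncomputable def stdSeq (b α β : ℝ) : ℕ → ℝ
  | 0 => 1
  | i + 1 => stdSeq b α β i * ((1 + α * bracket b i) / (β - α * bracket b i))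

lemma stdSeq_pos {b α β : ℝ} (hb : 1 < b) (hα : 0 ≤ α) {D : ℕ}
    (hβ : ∀ i < D, α * bracket b i < β) {i : ℕ} (hi : i ≤ D) : 0 < stdSeq b α β i := by
  induction i with
  | zero => exact one_pos
  | succ i ih =>
    have h1 := mul_nonneg hα (bracket_nonneg hb i)
    have h2 := hβ i hi
    exact mul_pos (ih (by omega)) (div_pos (by linarith) (by linarith))

lemma stdSeq_succ_mul {b α β : ℝ} {i : ℕ} (h : α * bracket b i < β) :
    stdSeq b α β (i + 1) * (β - α * bracket b i) = stdSeq b α β i * (1 + α * bracket b i) := by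
  have h' : β - α * bracket b i ≠ 0 := by linarith
  simp only [stdSeq]
  field_simp

section Spheres

variable {V : Type*} {G : SimpleGraph V} {B C : ℕ → ℕ}

lemma HasIntersectionNumbers.dist_le_add_one (h : HasIntersectionNumbers G B C) (x : V) {y z : V}
    (hyz : G.Adj y z) : G.dist x z ≤ G.dist x y + 1 := by
  have := h.1.dist_triangle (u := x) (v := y) (w := z)
  rwa [SimpleGraph.dist_eq_one_iff_adj.2 hyz] at this

variable [Fintype V] [DecidableRel G.Adj]

lemma HasIntersectionNumbers.degree_eq (h : HasIntersectionNumbers G B C) (x : V) :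
    G.degree x = B 0 := by
  have h1 := (h.2 x x).2
  rw [SimpleGraph.dist_self] at h1
  rw [← h1, ← SimpleGraph.card_neighborFinset_eq_degree, ← Set.ncard_coe_finset]
  congr 1
  ext z
  simp [SimpleGraph.dist_eq_one_iff_adj]

lemma HasIntersectionNumbers.sum_neighbor (h : HasIntersectionNumbers G B C) (g : ℕ → ℝ)
    (x y : V) :
    ∑ z ∈ G.neighborFinset y, g (G.dist x z) =
      C (G.dist x y) * g (G.dist x y - 1) + B (G.dist x y) * g (G.dist x y + 1) +
        ((B 0 : ℝ) - B (G.dist x y) - C (G.dist x y)) * g (G.dist x y) := by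
  classical
  set i := G.dist x y with hi
  have key : ∀ z ∈ G.neighborFinset y, g (G.dist x z) = g i +
      (if G.dist x z + 1 = i then g (i - 1) - g i else 0) +
      (if G.dist x z = i + 1 then g (i + 1) - g i else 0) := by
    intro z hz
    rw [SimpleGraph.mem_neighborFinset] at hz
    have h1 := h.dist_le_add_one x hz
    have h2 := h.dist_le_add_one x hz.symm
    rcases (by omega : G.dist x z + 1 = i ∨ G.dist x z = i ∨ G.dist x z = i + 1) with h' | h' | h'
    · rw [if_pos h', if_neg (by omega), ← h']
      simp
    · rw [if_neg (by omega), if_neg (by omega), h']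
      simp
    · rw [if_neg (by omega), if_pos h', h']
      simp
  have hC : (((G.neighborFinset y).filter fun z => G.dist x z + 1 = i).card : ℝ) = C i := by
    rw [← (h.2 x y).1, ← Set.ncard_coe_finset]
    congr 3
    ext z
    simp [hi]
  have hB : (((G.neighborFinset y).filter fun z => G.dist x z = i + 1).card : ℝ) = B i := by
    rw [← (h.2 x y).2, ← Set.ncard_coe_finset]
    congr 3
    ext z
    simp [hi]
  rw [Finset.sum_congr rfl key, Finset.sum_add_distrib, Finset.sum_add_distrib,
    ← Finset.sum_filter, ← Finset.sum_filter, Finset.sum_const, Finset.sum_const, Finset.sum_const,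
    nsmul_eq_mul, nsmul_eq_mul, nsmul_eq_mul, hC, hB, SimpleGraph.card_neighborFinset_eq_degree,
    h.degree_eq]
  ring

end Spheres

/-! ### The smallest eigenvalue is `-[D]`. -/

/-- The intersection numbers are those of the classical parameters `(D, b, α, β)`, and `b` and `α`
are such that the smallest eigenvalue is `-[D]`. -/
structure ClassicalNumbers {V : Type*} (G : SimpleGraph V) (D : ℕ) (b α β : ℝ) (B C : ℕ → ℕ) :
    Prop where
  one_lt : 1 < b
  nonneg : 0 ≤ α
  lt : ∀ i < D, α * bracket b i < β
  dist_le : ∀ x y, G.dist x y ≤ D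
  numbers : HasIntersectionNumbers G B C
  B_eq : ∀ i ≤ D, (B i : ℝ) = (bracket b D - bracket b i) * (β - α * bracket b i)
  C_eq : ∀ i ≤ D, (C i : ℝ) = bracket b i * (1 + α * bracket b (i - 1))

section Eigenvalue

variable {V : Type*} {G : SimpleGraph V} {B C : ℕ → ℕ} {D : ℕ} {b α β : ℝ}

/-- The formulas for `B` and `C` are extended to the boundary indices: `B D = 0` since no vertex is
farther than the diameter, and `C 0 = 0`. -/
lemma HasClassicalParameters.classicalNumbers [Finite V]
    (h : HasClassicalParameters G D b α β) (hb : 1 < b)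
    (hα : 0 ≤ α) (hβ : ∀ i < D, α * bracket b i < β) :
    ∃ B C : ℕ → ℕ, ClassicalNumbers G D b α β B C := by
  obtain ⟨hD, B, C, hBC, hB, hC⟩ := h
  have hne := hBC.1.nonempty
  have hdist : ∀ x y, G.dist x y ≤ D := fun x y => by
    rw [← hD]
    exact SimpleGraph.dist_le_diam (SimpleGraph.connected_iff_ediam_ne_top.1 hBC.1)
  obtain ⟨x, y, hxy⟩ := G.exists_dist_eq_diam
  refine ⟨B, C, hb, hα, hβ, hdist, hBC, fun i hi => ?_, fun i hi => ?_⟩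
  · rcases hi.lt_or_eq with hi | rfl
    · exact hB i hi
    · have h1 := (hBC.2 x y).2
      rw [hxy, hD] at h1
      have h2 : {z | G.Adj y z ∧ G.dist x z = i + 1} = ∅ := by
        ext z
        have := hdist x z
        simp only [Set.mem_ofPred_eq, Set.mem_empty_iff_false, iff_false, not_and]
        intro _
        omega
      rw [h2, Set.ncard_empty] at h1
      simp [← h1]
  · rcases Nat.eq_zero_or_pos i with rfl | hi'
    · have h1 := (hBC.2 x x).1
      rw [SimpleGraph.dist_self] at h1
      simp only [Nat.succ_ne_zero, and_false, Set.ofPred_false, Set.ncard_empty] at h1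
      simp [← h1, bracket_zero hb.ne']
    · exact hC i hi' hi

namespace ClassicalNumbers

lemma B_zero (h : ClassicalNumbers G D b α β B C) : (B 0 : ℝ) = bracket b D * β := by
  simpa [bracket_zero h.one_lt.ne'] using h.B_eq 0 (Nat.zero_le _)

/-- This is the three-term recurrence for the eigenvalue `-[D]` with alternating signs removed. The
out-of-range terms at `i = 0` and `i = D` are harmless because `C 0 = 0` and `B D = 0`. -/
lemma stdSeq_recurrence (h : ClassicalNumbers G D b α β B C) {i : ℕ} (hi : i ≤ D) :
    C i * stdSeq b α β (i - 1) + B i * stdSeq b α β (i + 1) =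
      (bracket b D + ((B 0 : ℝ) - B i - C i)) * stdSeq b α β i := by
  have hC : C i * stdSeq b α β (i - 1) =
      bracket b i * (β - α * bracket b (i - 1)) * stdSeq b α β i := by
    rw [h.C_eq i hi]
    rcases i with _ | j
    · simp [bracket_zero h.one_lt.ne']
    · have := stdSeq_succ_mul (h.lt j hi)
      rw [Nat.add_sub_cancel]
      linear_combination (-bracket b (j + 1)) * this
  have hB : B i * stdSeq b α β (i + 1) =
      (bracket b D - bracket b i) * (1 + α * bracket b i) * stdSeq b α β i := by
    rw [h.B_eq i hi]
    rcases hi.lt_or_eq with hi | rfl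
    · have := stdSeq_succ_mul (h.lt i hi)
      linear_combination (bracket b D - bracket b i) * this
    · simp
  rw [hC, hB, h.B_zero, h.B_eq i hi, h.C_eq i hi]
  ring

variable [Fintype V] [DecidableRel G.Adj]

lemma sum_neighbor_stdSeq (h : ClassicalNumbers G D b α β B C) (x y : V) :
    ∑ z ∈ G.neighborFinset y, (-1) ^ G.dist x z * stdSeq b α β (G.dist x z) =
      -bracket b D * ((-1) ^ G.dist x y * stdSeq b α β (G.dist x y)) := by
  rw [h.numbers.sum_neighbor (fun i => (-1) ^ i * stdSeq b α β i)]
  have h1 := h.stdSeq_recurrence (h.dist_le x y)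
  have hC := h.C_eq _ (h.dist_le x y)
  set i := G.dist x y
  rcases i with _ | j
  · rw [bracket_zero h.one_lt.ne', zero_mul] at hC
    rw [hC] at h1 ⊢
    simp only [pow_zero, pow_succ] at h1 ⊢
    linear_combination -h1
  · simp only [Nat.add_sub_cancel, pow_succ] at h1 ⊢
    linear_combination ((-1) ^ j : ℝ) * h1

/-- Choose `x` with `v x ≠ 0`, let `w i` be the sum of `v` over the sphere of radius `i` about `x`,
and pair `v` with the radial function `s i * u i`, where `s i` is a sign of `w i`. Moving the
adjacency operator across the pairing gives `θ * ∑ |w i| u i`; by positivity of `u` and its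
recurrence this is at least `-[D] * ∑ |w i| u i`. The last sum is positive since `w 0 = v x`. -/
lemma neg_bracket_le_of_sum_neighbor (h : ClassicalNumbers G D b α β B C) {θ : ℝ} {v : V → ℝ}
    (hv : v ≠ 0)
    (hθ : ∀ y, ∑ z ∈ G.neighborFinset y, v z = θ * v y) : -bracket b D ≤ θ := by
  classical
  obtain ⟨x, hx⟩ := Function.ne_iff.1 hv
  let w : ℕ → ℝ := fun i => ∑ y with G.dist x y = i, v y
  have hsum : ∀ g : ℕ → ℝ, ∑ y, v y * g (G.dist x y) = ∑ i ∈ Finset.range (D + 1), w i * g i := by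
    intro g
    rw [← Finset.sum_fiberwise_of_maps_to (s := Finset.univ) (t := Finset.range (D + 1))
      (g := fun y => G.dist x y) fun y _ => Finset.mem_range_succ_iff.2 (h.dist_le x y)]
    refine Finset.sum_congr rfl fun i _ => ?_
    rw [Finset.sum_mul]
    refine Finset.sum_congr rfl fun y hy => ?_
    rw [(Finset.mem_filter.1 hy).2]
  have hs : ∀ i, ∃ s : ℝ, |s| ≤ 1 ∧ w i * s = |w i| := by
    intro i
    rcases le_total 0 (w i) with hw | hw
    · exact ⟨1, by simp, by simp [abs_of_nonneg hw]⟩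
    · exact ⟨-1, by simp, by simp [abs_of_nonpos hw]⟩
  choose s hs1 hs2 using hs
  let u := stdSeq b α β
  have hu : ∀ i ≤ D, 0 < u i := fun i hi => stdSeq_pos h.one_lt h.nonneg h.lt hi
  have hadj : θ * ∑ y, v y * (s (G.dist x y) * u (G.dist x y)) =
      ∑ z, v z * ∑ y ∈ G.neighborFinset z, s (G.dist x y) * u (G.dist x y) := by
    simp only [Finset.mul_sum]
    rw [Finset.sum_comm' (t' := Finset.univ) (s' := fun y => G.neighborFinset y)
      (by simp [SimpleGraph.adj_comm])]
    refine Finset.sum_congr rfl fun y _ => ?_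
    rw [← Finset.sum_mul, hθ y]
    ring
  simp only [h.numbers.sum_neighbor fun i => s i * u i] at hadj
  rw [hsum fun i => s i * u i, hsum fun i => C i * (s (i - 1) * u (i - 1)) +
    B i * (s (i + 1) * u (i + 1)) + ((B 0 : ℝ) - B i - C i) * (s i * u i)] at hadj
  have hle : ∀ i ∈ Finset.range (D + 1), -bracket b D * (|w i| * u i) ≤
      w i * (C i * (s (i - 1) * u (i - 1)) +
        B i * (s (i + 1) * u (i + 1)) + ((B 0 : ℝ) - B i - C i) * (s i * u i)) := by
    intro i hi
    have hiD := Finset.mem_range_succ_iff.1 hi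
    have hrec := h.stdSeq_recurrence hiD
    have hterm : ∀ (c t : ℝ) (j : ℕ), |t| ≤ 1 → 0 ≤ c * u j →
        -(|w i| * (c * u j)) ≤ w i * (c * (t * u j)) := by
      intro c t j ht hc
      have h1 : |w i * t| ≤ |w i| := by
        rw [abs_mul]
        exact mul_le_of_le_one_right (abs_nonneg _) ht
      nlinarith [neg_abs_le (w i * t)]
    have hC := hterm (C i) (s (i - 1)) (i - 1) (hs1 _)
      (mul_nonneg (Nat.cast_nonneg _) (hu _ (by omega)).le)
    -- For `i = D` the sign of `u (D + 1)` is not known, but `B D = 0`.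
    have hB0 : 0 ≤ B i * u (i + 1) := by
      rcases hiD.lt_or_eq with h' | rfl
      · exact mul_nonneg (Nat.cast_nonneg _) (hu _ h').le
      · rw [h.B_eq i le_rfl]
        simp
    have hB := hterm (B i) (s (i + 1)) (i + 1) (hs1 _) hB0
    have hself : w i * (((B 0 : ℝ) - B i - C i) * (s i * u i)) =
        ((B 0 : ℝ) - B i - C i) * (|w i| * u i) := by
      rw [← hs2 i]
      ring
    have hrec' : |w i| * (C i * u (i - 1)) + |w i| * (B i * u (i + 1)) =
        (bracket b D + ((B 0 : ℝ) - B i - C i)) * (|w i| * u i) := by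
      linear_combination |w i| * hrec
    linarith
  have hpos : 0 < ∑ i ∈ Finset.range (D + 1), |w i| * u i := by
    refine Finset.sum_pos' (fun i hi => mul_nonneg (abs_nonneg _)
      (hu i (Finset.mem_range_succ_iff.1 hi)).le) ⟨0, by simp, ?_⟩
    refine mul_pos (abs_pos.2 ?_) (hu 0 (Nat.zero_le _))
    have : (Finset.univ.filter fun y => G.dist x y = 0) = {x} := by
      ext y
      rw [Finset.mem_filter, Finset.mem_singleton, h.numbers.1.dist_eq_zero_iff]
      simp [eq_comm]
    simp only [w]
    rw [this, Finset.sum_singleton]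
    exact hx
  have hfin := Finset.sum_le_sum hle
  rw [← hadj, ← Finset.mul_sum] at hfin
  have heq : ∑ i ∈ Finset.range (D + 1), w i * (s i * u i) =
      ∑ i ∈ Finset.range (D + 1), |w i| * u i :=
    Finset.sum_congr rfl fun i _ => by rw [← hs2 i]; ring
  rw [heq] at hfin
  exact le_of_mul_le_mul_right hfin hpos

lemma smallestEigenvalue_eq [DecidableEq V] (h : ClassicalNumbers G D b α β B C) {θ : ℝ}
    (hθ : IsSmallestEigenvalue G θ) :
    θ = -bracket b D := by
  have hmul : ∀ (v : V → ℝ) (y : V),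
      Matrix.toLin' (G.adjMatrix ℝ) v y = ∑ z ∈ G.neighborFinset y, v z := fun v y => by
    rw [Matrix.toLin'_apply, SimpleGraph.adjMatrix_mulVec_apply]
  apply le_antisymm
  · apply hθ.2
    obtain ⟨x⟩ := h.numbers.1.nonempty
    refine Module.End.hasEigenvalue_of_hasEigenvector
      (x := fun y => (-1) ^ G.dist x y * stdSeq b α β (G.dist x y)) ⟨?_, fun h0 => ?_⟩
    · rw [Module.End.mem_eigenspace_iff]
      ext y
      rw [hmul, h.sum_neighbor_stdSeq]
      rfl
    · have := congrFun h0 x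
      simp [stdSeq] at this
  · obtain ⟨v, hv, hv0⟩ := hθ.1.exists_hasEigenvector
    refine h.neg_bracket_le_of_sum_neighbor hv0 fun y => ?_
    rw [← hmul, Module.End.mem_eigenspace_iff.1 hv]
    rfl

end ClassicalNumbers

end Eigenvalue

/-! ### Line systems and counting along the lines through a point. -/

section Lines

variable {V : Type*} [Fintype V]

open Classical in
/-- The members of `𝓒` through the point `x`. -/
noncomputable def linesThrough (𝓒 : Set (Finset V)) (x : V) : Finset (Finset V) :=
  Finset.univ.filter fun K => K ∈ 𝓒 ∧ x ∈ K

lemma mem_linesThrough {𝓒 : Set (Finset V)} {x : V} {K : Finset V} :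
    K ∈ linesThrough 𝓒 x ↔ K ∈ 𝓒 ∧ x ∈ K := by
  simp [linesThrough]

/-- The members of `𝓒` are cliques of `G`, and each edge is in exactly one of them. -/
structure IsLineSystem (G : SimpleGraph V) (𝓒 : Set (Finset V)) : Prop where
  isClique : ∀ K ∈ 𝓒, G.IsClique (K : Set V)
  exists_line : ∀ x y, G.Adj x y → ∃ K ∈ 𝓒, x ∈ K ∧ y ∈ K
  eq_of_mem : ∀ x y, x ≠ y → ∀ K ∈ 𝓒, ∀ L ∈ 𝓒, x ∈ K → y ∈ K → x ∈ L → y ∈ L → K = L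

namespace IsLineSystem

variable [DecidableEq V] {G : SimpleGraph V} {𝓒 : Set (Finset V)}

lemma sum_neighbor [DecidableRel G.Adj] (h : IsLineSystem G 𝓒) (f : V → ℝ) (x : V) :
    ∑ K ∈ linesThrough 𝓒 x, ∑ y ∈ K.erase x, f y = ∑ y ∈ G.neighborFinset x, f y := by
  classical
  rw [Finset.sum_comm' (t' := G.neighborFinset x)
    (s' := fun y => (linesThrough 𝓒 x).filter fun K => y ∈ K)]
  · refine Finset.sum_congr rfl fun y hy => ?_
    rw [SimpleGraph.mem_neighborFinset] at hy
    obtain ⟨K, hK, hxK, hyK⟩ := h.exists_line x y hy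
    have : (linesThrough 𝓒 x).filter (fun K => y ∈ K) = {K} := by
      ext L
      simp only [Finset.mem_filter, mem_linesThrough, Finset.mem_singleton]
      refine ⟨fun hL => h.eq_of_mem x y hy.ne L hL.1.1 K hK hL.1.2 hL.2 hxK hyK, ?_⟩
      rintro rfl
      exact ⟨⟨hK, hxK⟩, hyK⟩
    rw [this, Finset.sum_singleton]
  · intro K y
    simp only [Finset.mem_filter, mem_linesThrough, Finset.mem_erase,
      SimpleGraph.mem_neighborFinset]
    constructor
    · rintro ⟨hK, hyx, hy⟩
      exact ⟨⟨hK, hy⟩, h.isClique K hK.1 hK.2 hy hyx.symm⟩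
    · rintro ⟨⟨hK, hy⟩, hxy⟩
      exact ⟨hK, hxy.ne', hy⟩

lemma card_eq_sum (h : IsLineSystem G 𝓒) {x : V} {S : Finset V} (hS : ∀ y ∈ S, G.Adj x y) :
    (S.card : ℝ) = ∑ K ∈ linesThrough 𝓒 x, ((S ∩ K).card : ℝ) := by
  classical
  have h1 := h.sum_neighbor (fun y => if y ∈ S then 1 else 0) x
  simp only [← Finset.sum_filter, Finset.sum_const, nsmul_eq_mul, mul_one] at h1
  have h2 : (G.neighborFinset x).filter (fun y => y ∈ S) = S := by
    ext y
    simp only [Finset.mem_filter, SimpleGraph.mem_neighborFinset]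
    exact ⟨fun hy => hy.2, fun hy => ⟨hS y hy, hy⟩⟩
  rw [h2] at h1
  refine h1.symm.trans ?_
  refine Finset.sum_congr rfl fun K _ => ?_
  congr 2
  ext y
  simp only [Finset.mem_inter, Finset.mem_filter, Finset.mem_erase]
  exact ⟨fun hy => ⟨hy.2, hy.1.2⟩, fun hy => ⟨⟨(hS y hy.1).ne', hy.2⟩, hy.1⟩⟩

/-- With `M` the point-line incidence matrix, `M Mᵀ = A + r I`. So `A f = -r f` gives `‖Mᵀ f‖² = 0`,
and the entries of `Mᵀ f` are the line sums. -/
lemma sum_line_eq_zero [DecidableRel G.Adj] (h : IsLineSystem G 𝓒) {r : ℝ}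
    (hr : ∀ x, ((linesThrough 𝓒 x).card : ℝ) = r) {f : V → ℝ}
    (hf : ∀ x, ∑ y ∈ G.neighborFinset x, f y = -r * f x) {K : Finset V} (hK : K ∈ 𝓒) :
    ∑ y ∈ K, f y = 0 := by
  classical
  have hpoint : ∀ x, ∑ K ∈ linesThrough 𝓒 x, ∑ y ∈ K, f y = 0 := by
    intro x
    have h1 : ∀ K ∈ linesThrough 𝓒 x, ∑ y ∈ K, f y = f x + ∑ y ∈ K.erase x, f y := fun K hK =>
      (Finset.add_sum_erase K f (mem_linesThrough.1 hK).2).symm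
    rw [Finset.sum_congr rfl h1, Finset.sum_add_distrib, h.sum_neighbor, hf, Finset.sum_const,
      nsmul_eq_mul, hr]
    ring
  have hsq : ∑ K ∈ Finset.univ.filter (· ∈ 𝓒), (∑ y ∈ K, f y) ^ 2 = 0 := by
    have h2 : ∀ K ∈ Finset.univ.filter (· ∈ 𝓒), (∑ y ∈ K, f y) ^ 2 =
        ∑ x ∈ K, f x * ∑ y ∈ K, f y := fun K _ => by rw [sq, Finset.sum_mul]
    rw [Finset.sum_congr rfl h2, Finset.sum_comm' (t' := Finset.univ)
      (s' := fun x => linesThrough 𝓒 x) (by simp [mem_linesThrough])]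
    simp only [← Finset.mul_sum, hpoint, mul_zero, Finset.sum_const_zero]
  exact pow_eq_zero_iff two_ne_zero |>.1
    ((Finset.sum_eq_zero_iff_of_nonneg fun K _ => sq_nonneg _).1 hsq K (by simpa using hK))

end IsLineSystem

end Lines

/-! ### Incidence numbers between points and lines. -/

/-- The incidence properties of a geometric distance-regular graph with classical parameters
`(D, b, α, β)`, `D ≥ 3`, and `r = [D]`, up to distance two. -/
structure IsClassicalGeometry {V : Type*} [Fintype V] [DecidableEq V] (G : SimpleGraph V)
    [DecidableRel G.Adj] (𝓒 : Set (Finset V)) (b α β r : ℝ) : Prop extends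
    IsLineSystem G 𝓒 where
  connected : G.Connected
  card_line : ∀ K ∈ 𝓒, (K.card : ℝ) = 1 + β
  card_lines : ∀ x, ((linesThrough 𝓒 x).card : ℝ) = r
  card_dist_one : ∀ K ∈ 𝓒, ∀ x ∉ K, (∃ y ∈ K, G.Adj x y) →
    ((G.neighborFinset x ∩ K).card : ℝ) = 1 + α
  card_dist_two : ∀ K ∈ 𝓒, ∀ x, (∀ y ∈ K, 2 ≤ G.dist x y) → (∃ y ∈ K, G.dist x y = 2) →
    ((K.filter fun y => G.dist x y = 2).card : ℝ) = 1 + α * (1 + b)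
  card_common : ∀ x y, G.dist x y = 2 →
    ((G.neighborFinset x ∩ G.neighborFinset y).card : ℝ) = (1 + b) * (1 + α)

section

variable {V : Type*} [Fintype V] [DecidableEq V] {G : SimpleGraph V} [DecidableRel G.Adj]
  {𝓒 : Set (Finset V)} {B C : ℕ → ℕ} {D : ℕ} {b α β : ℝ}

lemma IsDelsarteClique.card_eq (h : ClassicalNumbers G D b α β B C) (hD : 0 < D) {K : Finset V}
    (hK : IsDelsarteClique G K) : (K.card : ℝ) = 1 + β := by
  obtain ⟨-, k, θ, hk, hθ, hcard⟩ := hK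
  obtain ⟨x⟩ := h.numbers.1.nonempty
  have hpos : 0 < bracket b D := by
    have := bracket_mono h.one_lt (show 1 ≤ D by omega)
    rw [bracket_one h.one_lt.ne'] at this
    linarith
  rw [hcard, h.smallestEigenvalue_eq hθ, neg_neg, ← hk x, h.numbers.degree_eq, h.B_zero,
    mul_div_cancel_left₀ _ hpos.ne']

lemma ClassicalNumbers.card_linesThrough (h : ClassicalNumbers G D b α β B C) (hD : 0 < D)
    (hL : IsLineSystem G 𝓒) (hK : ∀ K ∈ 𝓒, (K.card : ℝ) = 1 + β) (x : V) :
    ((linesThrough 𝓒 x).card : ℝ) = bracket b D := by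
  have hβ : 0 < β := by simpa [bracket_zero h.one_lt.ne'] using h.lt 0 hD
  have h1 := hL.sum_neighbor (fun _ => 1) x
  have h2 : ∀ K ∈ linesThrough 𝓒 x, ∑ y ∈ K.erase x, (1 : ℝ) = β := fun K hKx => by
    have hx := (mem_linesThrough.1 hKx).2
    have := hK K (mem_linesThrough.1 hKx).1
    rw [← Finset.card_erase_add_one hx] at this
    push_cast at this
    rw [Finset.sum_const, nsmul_one]
    linarith
  rw [Finset.sum_congr rfl h2, Finset.sum_const, Finset.sum_const, nsmul_one, nsmul_eq_mul,
    SimpleGraph.card_neighborFinset_eq_degree, h.numbers.degree_eq, h.B_zero] at h1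
  exact mul_right_cancel₀ hβ.ne' h1

/-- The line lies in the spheres of radius `i` and `i + 1` about `x`, so the zero line sum of the
alternating standard sequence fixes the ratio of the two parts, and the line size `1 + β` fixes
both. -/
lemma ClassicalNumbers.card_nearest (h : ClassicalNumbers G D b α β B C)
    (hL : IsLineSystem G 𝓒) (hK : ∀ K ∈ 𝓒, (K.card : ℝ) = 1 + β)
    (hr : ∀ x, ((linesThrough 𝓒 x).card : ℝ) = bracket b D) {K : Finset V} (hKC : K ∈ 𝓒) {x : V}
    {i : ℕ} (hi : i < D) (hle : ∀ y ∈ K, i ≤ G.dist x y) (hex : ∃ y ∈ K, G.dist x y = i) :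
    ((K.filter fun y => G.dist x y = i).card : ℝ) = 1 + α * bracket b i := by
  have hsum := hL.sum_line_eq_zero hr (fun y => h.sum_neighbor_stdSeq x y) hKC
  obtain ⟨y₀, hy₀, hi₀⟩ := hex
  have hdist : ∀ y ∈ K, G.dist x y = i ∨ G.dist x y = i + 1 := by
    intro y hy
    have h1 := hle y hy
    rcases eq_or_ne y₀ y with rfl | hne
    · exact Or.inl hi₀
    · have h2 := h.numbers.dist_le_add_one x (hL.isClique K hKC hy₀ hy hne)
      omega
  set u := stdSeq b α β
  set S := K.filter fun y => G.dist x y = i with hS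
  set T := K.filter fun y => ¬ G.dist x y = i with hT
  have hST : (S.card : ℝ) + T.card = 1 + β := by
    rw [← hK K hKC]
    exact_mod_cast Finset.card_filter_add_card_filter_not (s := K) fun y => G.dist x y = i
  rw [← Finset.sum_filter_add_sum_filter_not K fun y => G.dist x y = i, ← hS, ← hT,
    Finset.sum_congr rfl (g := fun _ => (-1) ^ i * u i)
      (fun y hy => by rw [(Finset.mem_filter.1 hy).2]),
    Finset.sum_congr (s₁ := T) rfl (g := fun _ => (-1) ^ (i + 1) * u (i + 1))
      (fun y hy => by
        rw [(hdist y (Finset.mem_filter.1 hy).1).resolve_left (Finset.mem_filter.1 hy).2]),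
    Finset.sum_const, Finset.sum_const, nsmul_eq_mul, nsmul_eq_mul, pow_succ] at hsum
  have hne : ((-1) ^ i : ℝ) ≠ 0 := by simp
  have h1 : S.card * u i = T.card * u (i + 1) := by
    apply mul_left_cancel₀ hne
    linear_combination hsum
  have h2 := stdSeq_succ_mul (h.lt i hi)
  have h3 : u i ≠ 0 := (stdSeq_pos h.one_lt h.nonneg h.lt hi.le).ne'
  have h4 : (S.card : ℝ) * (β - α * bracket b i) = T.card * (1 + α * bracket b i) := by
    apply mul_left_cancel₀ h3
    linear_combination (β - α * bracket b i) * h1 + T.card * h2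
  have h5 : 1 + β ≠ 0 := by
    have := h.lt i hi
    have := mul_nonneg h.nonneg (bracket_nonneg h.one_lt i)
    linarith
  apply mul_left_cancel₀ h5
  linear_combination h4 + (1 + α * bracket b i) * hST

lemma ClassicalNumbers.isClassicalGeometry (h : ClassicalNumbers G D b α β B C) (hD : 3 ≤ D)
    (hL : IsLineSystem G 𝓒) (hDel : ∀ K ∈ 𝓒, IsDelsarteClique G K) :
    IsClassicalGeometry G 𝓒 b α β (bracket b D) := by
  have hb := h.one_lt.ne'
  have hK : ∀ K ∈ 𝓒, (K.card : ℝ) = 1 + β := fun K hKC => (hDel K hKC).card_eq h (by omega)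
  have hr := h.card_linesThrough (by omega) hL hK
  refine { hL with
    connected := h.numbers.1
    card_line := hK
    card_lines := hr
    card_dist_one := ?_
    card_dist_two := ?_
    card_common := ?_ }
  · rintro K hKC x hx ⟨y, hy, hxy⟩
    have := h.card_nearest hL hK hr hKC (x := x) (i := 1) (by omega)
      (fun z hz => Nat.one_le_iff_ne_zero.2 fun h0 =>
        hx (h.numbers.1.dist_eq_zero_iff.1 h0 ▸ hz))
      ⟨y, hy, SimpleGraph.dist_eq_one_iff_adj.2 hxy⟩
    rw [bracket_one hb, mul_one] at this
    rw [← this]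
    congr 2
    ext z
    simp [SimpleGraph.dist_eq_one_iff_adj, and_comm]
  · intro K hKC x h2 hex
    rw [h.card_nearest hL hK hr hKC (by omega) h2 hex, bracket_two hb]
  · intro x y hxy
    have h1 := (h.numbers.2 x y).1
    have h2 := h.C_eq 2 (by omega)
    rw [bracket_two hb, bracket_one hb, mul_one] at h2
    rw [hxy] at h1
    rw [← h2, ← h1, ← Set.ncard_coe_finset]
    congr 2
    ext z
    simp [SimpleGraph.dist_eq_one_iff_adj, and_comm]

end

lemma IsLineSystem.dist_le_one {V : Type*} {G : SimpleGraph V} {𝓒 : Set (Finset V)}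
    {M : Finset V} (h : IsLineSystem G 𝓒) (hM : M ∈ 𝓒) {u w : V} (hu : u ∈ M) (hw : w ∈ M) :
    G.dist u w ≤ 1 := by
  rcases eq_or_ne u w with rfl | hne
  · simp
  · exact (SimpleGraph.dist_eq_one_iff_adj.2 (h.isClique M hM hu hw hne)).le

/-! ### Near and far lines through a point at distance one from a line. -/

section

variable {V : Type*} [Fintype V]

open Classical in
/-- The lines through `z` that contain a neighbour of `p`. -/
noncomputable def linesMeetingNeighbors (G : SimpleGraph V) (𝓒 : Set (Finset V)) (z p : V) :
    Finset (Finset V) :=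
  (linesThrough 𝓒 z).filter fun M => ∃ w ∈ M, G.Adj p w

open Classical in
/-- The lines through `z` all of whose points are at distance at most one from `L`. -/
noncomputable def linesNear (G : SimpleGraph V) (𝓒 : Set (Finset V)) (z : V) (L : Finset V) :
    Finset (Finset V) :=
  (linesThrough 𝓒 z).filter fun M => ∀ w ∈ M, ∃ q ∈ L, G.dist w q ≤ 1

variable {G : SimpleGraph V} {𝓒 : Set (Finset V)} {z p : V} {L M : Finset V}

lemma mem_linesMeetingNeighbors :
    M ∈ linesMeetingNeighbors G 𝓒 z p ↔ (M ∈ 𝓒 ∧ z ∈ M) ∧ ∃ w ∈ M, G.Adj p w := by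
  simp [linesMeetingNeighbors, mem_linesThrough]

lemma mem_linesNear :
    M ∈ linesNear G 𝓒 z L ↔ (M ∈ 𝓒 ∧ z ∈ M) ∧ ∀ w ∈ M, ∃ q ∈ L, G.dist w q ≤ 1 := by
  simp [linesNear, mem_linesThrough]

lemma linesMeetingNeighbors_subset : linesMeetingNeighbors G 𝓒 z p ⊆ linesThrough 𝓒 z :=
  fun _ hM => mem_linesThrough.2 (mem_linesMeetingNeighbors.1 hM).1

lemma linesNear_subset_linesThrough : linesNear G 𝓒 z L ⊆ linesThrough 𝓒 z :=
  fun _ hM => mem_linesThrough.2 (mem_linesNear.1 hM).1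

lemma IsLineSystem.mem_linesNear_of_mem (h : IsLineSystem G 𝓒) (hM : M ∈ 𝓒) (hz : z ∈ M) {q : V}
    (hqM : q ∈ M) (hqL : q ∈ L) : M ∈ linesNear G 𝓒 z L :=
  mem_linesNear.2 ⟨⟨hM, hz⟩, fun _ hw => ⟨q, hqL, h.dist_le_one hM hw hqM⟩⟩

namespace IsClassicalGeometry

variable [DecidableEq V] [DecidableRel G.Adj] {b α β r : ℝ}

lemma dist_eq_two (h : IsClassicalGeometry G 𝓒 b α β r) {u v w : V} (huv : G.Adj u v)
    (hvw : G.dist v w ≤ 1) (hne : u ≠ w) (hadj : ¬ G.Adj u w) : G.dist u w = 2 := by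
  have h1 := h.connected.dist_triangle (u := u) (v := v) (w := w)
  rw [SimpleGraph.dist_eq_one_iff_adj.2 huv] at h1
  have h2 : G.dist u w ≠ 0 := fun h0 => hne (h.connected.dist_eq_zero_iff.1 h0)
  have h3 : G.dist u w ≠ 1 := fun h1 => hadj (SimpleGraph.dist_eq_one_iff_adj.1 h1)
  omega

/-- Count edges between `L` and `M`: there are `(1 + β)(1 + α)` from the side of `M`, but at most
`β(1 + α)` from the side of `L` if `p` contributes none. -/
lemma exists_adj_of_disjoint (h : IsClassicalGeometry G 𝓒 b α β r) (hα : 0 ≤ α) (hL : L ∈ 𝓒)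
    (hM : M ∈ 𝓒) (hML : ∀ w ∈ M, w ∉ L) (hnear : ∀ w ∈ M, ∃ q ∈ L, G.Adj w q) (hp : p ∈ L) :
    ∃ w ∈ M, G.Adj p w := by
  by_contra! hcon
  have hcount : ∑ w ∈ M, ((G.neighborFinset w ∩ L).card : ℝ) =
      ∑ q ∈ L, ((G.neighborFinset q ∩ M).card : ℝ) := by
    have := Finset.sum_card_bipartiteAbove_eq_sum_card_bipartiteBelow (s := M) (t := L)
      (fun w q => G.Adj w q)
    have h1 : ∀ w, G.neighborFinset w ∩ L = Finset.bipartiteAbove (fun w q => G.Adj w q) L w := by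
      intro w
      ext q
      simp [Finset.mem_bipartiteAbove, and_comm]
    have h2 : ∀ q, G.neighborFinset q ∩ M = Finset.bipartiteBelow (fun w q => G.Adj w q) M q := by
      intro q
      ext w
      simp [Finset.mem_bipartiteBelow, and_comm, G.adj_comm]
    simp only [h1, h2]
    exact_mod_cast this
  have hle : ∑ q ∈ L.erase p, ((G.neighborFinset q ∩ M).card : ℝ) ≤
      ∑ q ∈ L.erase p, (1 + α) := by
    refine Finset.sum_le_sum fun q hq => ?_
    by_cases hex : ∃ w ∈ M, G.Adj q w
    · exact (h.card_dist_one M hM q (fun hqM => hML q hqM (Finset.mem_of_mem_erase hq)) hex).le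
    · have : G.neighborFinset q ∩ M = ∅ := by
        ext w
        simp only [Finset.mem_inter, SimpleGraph.mem_neighborFinset, Finset.notMem_empty,
          iff_false]
        exact fun hw => hex ⟨w, hw.2, hw.1⟩
      rw [this]
      simp only [Finset.card_empty, Nat.cast_zero]
      linarith
  have hp0 : G.neighborFinset p ∩ M = ∅ := by
    ext w
    simp only [Finset.mem_inter, SimpleGraph.mem_neighborFinset, Finset.notMem_empty, iff_false]
    exact fun hw => hcon w hw.2 hw.1
  rw [Finset.sum_congr rfl fun w hw => h.card_dist_one L hL w (hML w hw) (hnear w hw),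
    ← Finset.add_sum_erase L _ hp, hp0] at hcount
  have hLc := h.card_line L hL
  rw [← Finset.card_erase_add_one hp] at hLc
  push_cast at hLc
  simp only [Finset.sum_const, nsmul_eq_mul, h.card_line M hM, Finset.card_empty,
    Nat.cast_zero, zero_add] at hcount hle
  rw [← hcount, ← hLc] at hle
  linarith

lemma linesNear_subset (h : IsClassicalGeometry G 𝓒 b α β r) (hα : 0 ≤ α) (hL : L ∈ 𝓒)
    (hp : p ∈ L) (hzp : G.dist z p = 2) :
    linesNear G 𝓒 z L ⊆ linesMeetingNeighbors G 𝓒 z p := by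
  intro M hM
  obtain ⟨⟨hMC, hzM⟩, hnear⟩ := mem_linesNear.1 hM
  refine mem_linesMeetingNeighbors.2 ⟨⟨hMC, hzM⟩, ?_⟩
  by_cases hML : ∃ q ∈ M, q ∈ L
  · obtain ⟨q, hqM, hqL⟩ := hML
    refine ⟨q, hqM, h.isClique L hL hp hqL ?_⟩
    rintro rfl
    have := h.dist_le_one hMC hzM hqM
    omega
  · push Not at hML
    refine h.exists_adj_of_disjoint hα hL hMC hML (fun w hw => ?_) hp
    obtain ⟨q, hq, hwq⟩ := hnear w hw
    refine ⟨q, hq, SimpleGraph.dist_eq_one_iff_adj.1 (le_antisymm hwq ?_)⟩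
    refine Nat.one_le_iff_ne_zero.2 fun h0 => hML w hw ?_
    rwa [h.connected.dist_eq_zero_iff.1 h0]

/-- The `c₂ = (1 + b)(1 + α)` common neighbours of `z` and `p` are split by the lines through `z`
into parts of size `1 + α` or `0`. -/
lemma card_linesMeetingNeighbors (h : IsClassicalGeometry G 𝓒 b α β r) (hα : 0 ≤ α)
    (hzp : G.dist z p = 2) : ((linesMeetingNeighbors G 𝓒 z p).card : ℝ) = 1 + b := by
  classical
  have h1 := h.card_eq_sum (x := z) (S := G.neighborFinset z ∩ G.neighborFinset p)
    fun y hy => by simpa using (Finset.mem_inter.1 hy).1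
  have h2 : ∀ K ∈ linesThrough 𝓒 z,
      (((G.neighborFinset z ∩ G.neighborFinset p) ∩ K).card : ℝ) =
        if ∃ w ∈ K, G.Adj p w then 1 + α else 0 := by
    intro K hK
    obtain ⟨hKC, hzK⟩ := mem_linesThrough.1 hK
    split_ifs with hex
    · rw [← h.card_dist_one K hKC p (fun hp => ?_) hex]
      · congr 2
        ext w
        simp only [Finset.mem_inter, SimpleGraph.mem_neighborFinset]
        refine ⟨fun hw => ⟨hw.1.2, hw.2⟩, fun hw => ⟨⟨h.isClique K hKC hzK hw.2 ?_, hw.1⟩, hw.2⟩⟩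
        rintro rfl
        rw [SimpleGraph.dist_eq_one_iff_adj.2 hw.1.symm] at hzp
        omega
      · have := h.dist_le_one hKC hzK hp
        omega
    · rw [Nat.cast_eq_zero, Finset.card_eq_zero]
      ext w
      simp only [Finset.mem_inter, SimpleGraph.mem_neighborFinset, Finset.notMem_empty, iff_false]
      exact fun hw => hex ⟨w, hw.2, hw.1.2⟩
  rw [Finset.sum_congr rfl h2, ← Finset.sum_filter, Finset.sum_const, nsmul_eq_mul,
    h.card_common z p hzp] at h1
  have h3 : (1 + α) ≠ 0 := by linarith
  have h4 := mul_right_cancel₀ h3 h1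
  rw [h4]
  simp only [linesMeetingNeighbors]
  congr!

/-- The lines joining `z` to its `1 + α` neighbours on `L` are distinct, since `z ∉ L`, and all are
near. -/
lemma le_card_linesNear (h : IsClassicalGeometry G 𝓒 b α β r) (hL : L ∈ 𝓒) (hz : z ∉ L)
    (hzL : ∃ q ∈ L, G.Adj z q) : 1 + α ≤ ((linesNear G 𝓒 z L).card : ℝ) := by
  classical
  have h1 := h.card_eq_sum (x := z) (S := G.neighborFinset z ∩ L)
    fun y hy => by simpa using (Finset.mem_inter.1 hy).1
  rw [← h.card_dist_one L hL z hz hzL, h1]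
  have h2 : ∀ K ∈ linesThrough 𝓒 z, (((G.neighborFinset z ∩ L) ∩ K).card : ℝ) ≤
      if ∀ w ∈ K, ∃ q ∈ L, G.dist w q ≤ 1 then 1 else 0 := by
    intro K hK
    obtain ⟨hKC, hzK⟩ := mem_linesThrough.1 hK
    split_ifs with hnear
    · rw [Nat.cast_le_one, Finset.card_le_one]
      intro u hu v hv
      simp only [Finset.mem_inter] at hu hv
      by_contra hne
      have := h.eq_of_mem u v hne K hKC L hL hu.2 hv.2 hu.1.2 hv.1.2
      exact hz (this ▸ hzK)
    · refine le_of_eq ?_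
      rw [Nat.cast_eq_zero, Finset.card_eq_zero]
      ext w
      simp only [Finset.mem_inter, SimpleGraph.mem_neighborFinset, Finset.notMem_empty, iff_false]
      exact fun hw => hnear (mem_linesNear.1 (h.mem_linesNear_of_mem hKC hzK hw.2 hw.1.2)).2
  refine (Finset.sum_le_sum h2).trans (le_of_eq ?_)
  rw [← Finset.sum_filter, Finset.sum_const, nsmul_one]
  simp only [linesNear]
  congr!

/-- This is where the bound on `β` enters. Each far line `M` has a point `w M` at distance two from
`L`, and `p` only has to avoid the neighbours of `z` and the sets `E M` of points of `L` at distance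
two from `w M`. Each `E M` contains those `1 + α` neighbours and only `αb` other points, and there
are at most `r - α - 1` far lines. -/
lemma exists_linesMeetingNeighbors_subset (h : IsClassicalGeometry G 𝓒 b α β r) (hα : 0 ≤ α)
    (hb : 0 ≤ b) (hβ : (r - α - 1) * α * b + α < β) (hL : L ∈ 𝓒) (hz : z ∉ L)
    (hzL : ∃ q ∈ L, G.Adj z q) :
    ∃ p ∈ L, G.dist z p = 2 ∧ linesMeetingNeighbors G 𝓒 z p ⊆ linesNear G 𝓒 z L := by
  classical
  have hw : ∀ M : Finset V, ∃ w, M ∈ linesThrough 𝓒 z \ linesNear G 𝓒 z L →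
      w ∈ M ∧ ∀ q ∈ L, 2 ≤ G.dist w q := by
    intro M
    by_cases hM : M ∈ linesThrough 𝓒 z \ linesNear G 𝓒 z L
    · rw [Finset.mem_sdiff, mem_linesNear, mem_linesThrough] at hM
      have h1 := hM.2
      push Not at h1
      obtain ⟨w, hw, hwL⟩ := h1 hM.1
      exact ⟨w, fun _ => ⟨hw, hwL⟩⟩
    -- `z` is a dummy value, making `w` total.
    · exact ⟨z, fun h' => absurd h' hM⟩
  choose w hw using hw
  obtain ⟨q₀, hq₀, hzq₀⟩ := hzL
  set N := G.neighborFinset z ∩ L with hN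
  let E : Finset V → Finset V := fun M => L.filter fun q => G.dist (w M) q = 2
  have hNE : ∀ M ∈ linesThrough 𝓒 z \ linesNear G 𝓒 z L, N ⊆ E M := by
    intro M hM q hq
    obtain ⟨hwM, hwL⟩ := hw M hM
    obtain ⟨hMC, hzM⟩ := mem_linesThrough.1 (Finset.mem_sdiff.1 hM).1
    rw [hN, Finset.mem_inter, SimpleGraph.mem_neighborFinset] at hq
    refine Finset.mem_filter.2 ⟨hq.2, le_antisymm ?_ (hwL q hq.2)⟩
    have h1 := h.connected.dist_triangle (u := w M) (v := z) (w := q)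
    have h2 := h.dist_le_one hMC hwM hzM
    rw [SimpleGraph.dist_eq_one_iff_adj.2 hq.1] at h1
    omega
  have hNcard : (N.card : ℝ) = 1 + α := h.card_dist_one L hL z hz ⟨q₀, hq₀, hzq₀⟩
  have hEcard : ∀ M ∈ linesThrough 𝓒 z \ linesNear G 𝓒 z L, ((E M \ N).card : ℝ) = α * b := by
    intro M hM
    have hq : q₀ ∈ E M := hNE M hM (by simp [hN, hq₀, hzq₀])
    have h1 := h.card_dist_two L hL (w M) (hw M hM).2
      ⟨q₀, hq₀, (Finset.mem_filter.1 hq).2⟩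
    rw [Finset.cast_card_sdiff (hNE M hM), hNcard]
    linarith
  set Q := linesThrough 𝓒 z \ linesNear G 𝓒 z L with hQ
  have hQcard : (Q.card : ℝ) ≤ r - α - 1 := by
    rw [hQ, Finset.cast_card_sdiff linesNear_subset_linesThrough, h.card_lines]
    have := h.le_card_linesNear hL hz ⟨q₀, hq₀, hzq₀⟩
    linarith
  have hbad : ((N ∪ Q.biUnion fun M => E M \ N).card : ℝ) < L.card := by
    calc ((N ∪ Q.biUnion fun M => E M \ N).card : ℝ)
        ≤ N.card + ∑ M ∈ Q, ((E M \ N).card : ℝ) := by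
          exact_mod_cast (Finset.card_union_le _ _).trans
            (Nat.add_le_add_left Finset.card_biUnion_le _)
      _ = 1 + α + Q.card * (α * b) := by
          rw [Finset.sum_congr rfl hEcard, hNcard, Finset.sum_const, nsmul_eq_mul]
      _ ≤ 1 + α + (r - α - 1) * (α * b) := by gcongr
      _ < L.card := by
          rw [h.card_line L hL]
          linarith
  obtain ⟨p, hp, hpbad⟩ := Finset.exists_mem_notMem_of_card_lt_card (Nat.cast_lt.1 hbad)
  rw [Finset.mem_union, not_or] at hpbad
  have hzp : ¬ G.Adj z p := fun hadj => hpbad.1 (by simp [hN, hp, hadj])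
  refine ⟨p, hp, h.dist_eq_two hzq₀ (h.dist_le_one hL hq₀ hp) (fun he => hz (he ▸ hp)) hzp, ?_⟩
  intro M hM
  obtain ⟨hMz, u, hu, hpu⟩ := mem_linesMeetingNeighbors.1 hM
  by_contra hMP
  have hMQ : M ∈ Q := Finset.mem_sdiff.2 ⟨mem_linesThrough.2 hMz, hMP⟩
  -- If a far line `M` had a point `u` adjacent to `p`, the path through `u` would put `p` within
  -- distance two of `w M`, hence in `E M`.
  refine hpbad.2 (Finset.mem_biUnion.2 ⟨M, hMQ, Finset.mem_sdiff.2 ⟨?_, hpbad.1⟩⟩)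
  obtain ⟨hwM, hwL⟩ := hw M hMQ
  refine Finset.mem_filter.2 ⟨hp, le_antisymm ?_ (hwL p hp)⟩
  have h1 := h.connected.dist_triangle (u := w M) (v := u) (w := p)
  have h2 := h.dist_le_one hMz.1 hwM hu
  rw [SimpleGraph.dist_eq_one_iff_adj.2 hpu.symm] at h1
  omega

lemma card_linesNear (h : IsClassicalGeometry G 𝓒 b α β r) (hα : 0 ≤ α)
    (hb : 0 ≤ b) (hβ : (r - α - 1) * α * b + α < β) (hL : L ∈ 𝓒) (hz : z ∉ L)
    (hzL : ∃ q ∈ L, G.Adj z q) : ((linesNear G 𝓒 z L).card : ℝ) = 1 + b := by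
  obtain ⟨p, hp, hzp, hsub⟩ := h.exists_linesMeetingNeighbors_subset hα hb hβ hL hz hzL
  rw [← h.card_linesMeetingNeighbors hα hzp, (h.linesNear_subset hα hL hp hzp).antisymm hsub]

lemma linesMeetingNeighbors_eq (h : IsClassicalGeometry G 𝓒 b α β r) (hα : 0 ≤ α)
    (hb : 0 ≤ b) (hβ : (r - α - 1) * α * b + α < β) (hL : L ∈ 𝓒) (hz : z ∉ L)
    (hzL : ∃ q ∈ L, G.Adj z q) (hp : p ∈ L) (hzp : G.dist z p = 2) :
    linesMeetingNeighbors G 𝓒 z p = linesNear G 𝓒 z L := by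
  refine (Finset.eq_of_subset_of_card_le (h.linesNear_subset hα hL hp hzp) ?_).symm
  have h1 := h.card_linesNear hα hb hβ hL hz hzL
  rw [← h.card_linesMeetingNeighbors hα hzp] at h1
  exact_mod_cast h1.ge

/-- On a line through `z` with points at distance two from `L`, the points with a neighbour on `L`
have the same neighbours on `L` as `z`. -/
lemma neighbors_inter_eq (h : IsClassicalGeometry G 𝓒 b α β r) (hα : 0 ≤ α)
    (hb : 0 ≤ b) (hβ : (r - α - 1) * α * b + α < β) (hL : L ∈ 𝓒) (hz : z ∉ L)
    (hzL : ∃ q ∈ L, G.Adj z q) (hM : M ∈ 𝓒) (hzM : z ∈ M) (hfar : M ∉ linesNear G 𝓒 z L) {w : V}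
    (hw : w ∈ M) (hwL : ∃ q ∈ L, G.Adj w q) :
    G.neighborFinset w ∩ L = G.neighborFinset z ∩ L := by
  have hwL' : w ∉ L := fun hmem => hfar (h.mem_linesNear_of_mem hM hzM hw hmem)
  refine Finset.eq_of_subset_of_card_le (fun p hp => ?_) ?_
  · rw [Finset.mem_inter, SimpleGraph.mem_neighborFinset] at hp ⊢
    -- If `p` were not adjacent to `z`, it would be at distance two from `z`, and `M`, which meets
    -- the neighbourhood of `p` in `w`, would be near.
    refine ⟨by_contra fun hzp => hfar ?_, hp.2⟩
    obtain ⟨q, hq, hzq⟩ := hzL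
    rw [← h.linesMeetingNeighbors_eq hα hb hβ hL hz ⟨q, hq, hzq⟩ hp.2
      (h.dist_eq_two hzq (h.dist_le_one hL hq hp.2) (fun he => hz (he ▸ hp.2)) hzp)]
    exact mem_linesMeetingNeighbors.2 ⟨⟨hM, hzM⟩, w, hw, hp.1.symm⟩
  · have h1 := h.card_dist_one L hL z hz hzL
    rw [← h.card_dist_one L hL w hwL' hwL] at h1
    exact_mod_cast h1.le

/-! ### Common neighbours of two adjacent vertices. -/

section CommonNeighbors

variable {x y : V}

/-- Each of the `r - 1` other lines through `x` contains `1 + α` neighbours of `y`, one of which is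
`x` itself. -/
lemma card_common_sdiff (h : IsClassicalGeometry G 𝓒 b α β r) (hxy : G.Adj x y) (hL : L ∈ 𝓒)
    (hx : x ∈ L) (hy : y ∈ L) :
    (((G.neighborFinset x ∩ G.neighborFinset y) \ L).card : ℝ) = (r - 1) * α := by
  set N := (G.neighborFinset x ∩ G.neighborFinset y) \ L with hN
  have hLx : L ∈ linesThrough 𝓒 x := mem_linesThrough.2 ⟨hL, hx⟩
  rw [h.card_eq_sum (x := x) (S := N) fun w hw => by
    simpa using (Finset.mem_inter.1 (Finset.mem_sdiff.1 hw).1).1, ← Finset.add_sum_erase _ _ hLx]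
  have h1 : N ∩ L = ∅ := by simp [hN]
  have h2 : ∀ K ∈ (linesThrough 𝓒 x).erase L, ((N ∩ K).card : ℝ) = α := by
    intro K hK
    obtain ⟨hKL, hK⟩ := Finset.mem_erase.1 hK
    obtain ⟨hKC, hxK⟩ := mem_linesThrough.1 hK
    have hyK : y ∉ K := fun hyK => hKL (h.eq_of_mem x y hxy.ne K hKC L hL hxK hyK hx hy)
    have h3 := h.card_dist_one K hKC y hyK ⟨x, hxK, hxy.symm⟩
    have h4 : N ∩ K = (G.neighborFinset y ∩ K).erase x := by
      ext w
      simp only [hN, Finset.mem_inter, Finset.mem_sdiff, SimpleGraph.mem_neighborFinset,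
        Finset.mem_erase]
      constructor
      · rintro ⟨⟨⟨hxw, hyw⟩, -⟩, hwK⟩
        exact ⟨hxw.ne', hyw, hwK⟩
      · rintro ⟨hwx, hyw, hwK⟩
        exact ⟨⟨⟨h.isClique K hKC hxK hwK hwx.symm, hyw⟩, fun hwL =>
          hKL (h.eq_of_mem x w hwx.symm K hKC L hL hxK hwK hx hwL)⟩, hwK⟩
    have hmem : x ∈ G.neighborFinset y ∩ K := by simp [hxK, hxy.symm]
    rw [← Finset.card_erase_add_one hmem, ← h4] at h3
    push_cast at h3
    linarith
  rw [Finset.sum_congr rfl h2, h1, Finset.sum_const, nsmul_eq_mul,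
    Finset.cast_card_erase_of_mem hLx, h.card_lines]
  simp

/-- On a far line the neighbours of `x` have the same neighbours on `L` as `z`, so they are
neighbours of `y` too. There are `1 + α` of them, including `z`. -/
lemma card_common_inter_line (h : IsClassicalGeometry G 𝓒 b α β r) (hα : 0 ≤ α)
    (hb : 0 ≤ b) (hβ : (r - α - 1) * α * b + α < β) (hL : L ∈ 𝓒) (hx : x ∈ L) (hy : y ∈ L)
    (hz : z ∈ (G.neighborFinset x ∩ G.neighborFinset y) \ L) (hM : M ∈ 𝓒) (hzM : z ∈ M)
    (hfar : M ∉ linesNear G 𝓒 z L) :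
    ((((G.neighborFinset x ∩ G.neighborFinset y) \ L) ∩ M).erase z |>.card : ℝ) = α := by
  have hzN := hz
  simp only [Finset.mem_inter, Finset.mem_sdiff, SimpleGraph.mem_neighborFinset] at hz
  obtain ⟨⟨hxz, hyz⟩, hzL⟩ := hz
  have hML : ∀ q ∈ M, q ∉ L := fun q hq hqL => hfar (h.mem_linesNear_of_mem hM hzM hq hqL)
  have h1 : ((G.neighborFinset x ∩ G.neighborFinset y) \ L) ∩ M = G.neighborFinset x ∩ M := by
    ext w
    simp only [Finset.mem_inter, Finset.mem_sdiff, SimpleGraph.mem_neighborFinset]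
    refine ⟨fun hw => ⟨hw.1.1.1, hw.2⟩, fun hw => ⟨⟨⟨hw.1, ?_⟩, hML w hw.2⟩, hw.2⟩⟩
    have h2 := h.neighbors_inter_eq hα hb hβ hL hzL ⟨x, hx, hxz.symm⟩ hM hzM hfar hw.2
      ⟨x, hx, hw.1.symm⟩
    have h3 : y ∈ G.neighborFinset z ∩ L := by simp [hy, hyz.symm]
    rw [← h2, Finset.mem_inter, SimpleGraph.mem_neighborFinset] at h3
    exact h3.1.symm
  have h2 := h.card_dist_one M hM x (fun hxM => hML x hxM hx) ⟨z, hzM, hxz⟩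
  rw [Finset.cast_card_erase_of_mem (Finset.mem_inter.2 ⟨hzN, hzM⟩), h1, h2]
  ring

/-- Each set of lines through `z` that are not near `L` gives many neighbours of `z` among the
common neighbours of `x` and `y`. -/
lemma card_mul_le_of_far (h : IsClassicalGeometry G 𝓒 b α β r) (hα : 0 ≤ α)
    (hb : 0 ≤ b) (hβ : (r - α - 1) * α * b + α < β) (hL : L ∈ 𝓒) (hx : x ∈ L) (hy : y ∈ L)
    (hz : z ∈ (G.neighborFinset x ∩ G.neighborFinset y) \ L) {R : Finset (Finset V)}
    (hR : R ⊆ linesThrough 𝓒 z \ linesNear G 𝓒 z L) {S : Finset V}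
    (hS : ∀ w ∈ (G.neighborFinset x ∩ G.neighborFinset y) \ L, ∀ M ∈ R, w ∈ M → w ≠ z → w ∈ S)
    (hSz : ∀ w ∈ S, G.Adj z w) : R.card * α ≤ (S.card : ℝ) := by
  rw [h.card_eq_sum hSz, ← nsmul_eq_mul, ← Finset.sum_const]
  refine le_trans (Finset.sum_le_sum fun M hM => ?_)
    (Finset.sum_le_sum_of_subset_of_nonneg (hR.trans Finset.sdiff_subset)
      fun _ _ _ => Nat.cast_nonneg _)
  obtain ⟨hMz, hfar⟩ := Finset.mem_sdiff.1 (hR hM)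
  obtain ⟨hMC, hzM⟩ := mem_linesThrough.1 hMz
  rw [← h.card_common_inter_line hα hb hβ hL hx hy hz hMC hzM hfar, Nat.cast_le]
  refine Finset.card_le_card fun w hw => ?_
  rw [Finset.mem_erase, Finset.mem_inter] at hw
  exact Finset.mem_inter.2 ⟨hS w hw.2.1 M hM hw.2.2 hw.1, hw.2.2⟩

/-- Two lines through `z`, namely those joining it to `x` and `y`, are near `L` and meet the
neighbourhood of `p`. -/
lemma two_le_card_inter (h : IsClassicalGeometry G 𝓒 b α β r) (hxy : G.Adj x y) (hL : L ∈ 𝓒)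
    (hx : x ∈ L) (hy : y ∈ L) (hz : z ∈ (G.neighborFinset x ∩ G.neighborFinset y) \ L)
    (hp : p ∈ (G.neighborFinset x ∩ G.neighborFinset y) \ L) :
    2 ≤ (linesNear G 𝓒 z L ∩ linesMeetingNeighbors G 𝓒 z p).card := by
  simp only [Finset.mem_inter, Finset.mem_sdiff, SimpleGraph.mem_neighborFinset] at hz hp
  obtain ⟨K, hK, hzK, hxK⟩ := h.exists_line z x hz.1.1.symm
  obtain ⟨K', hK', hzK', hyK'⟩ := h.exists_line z y hz.1.2.symm
  refine Finset.one_lt_card.2 ⟨K, ?_, K', ?_, ?_⟩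
  · exact Finset.mem_inter.2 ⟨h.mem_linesNear_of_mem hK hzK hxK hx,
      mem_linesMeetingNeighbors.2 ⟨⟨hK, hzK⟩, x, hxK, hp.1.1.symm⟩⟩
  · exact Finset.mem_inter.2 ⟨h.mem_linesNear_of_mem hK' hzK' hyK' hy,
      mem_linesMeetingNeighbors.2 ⟨⟨hK', hzK'⟩, y, hyK', hp.1.2.symm⟩⟩
  · rintro rfl
    exact hz.2 (h.eq_of_mem x y hxy.ne K hK L hL hxK hyK' hx hy ▸ hzK)

theorem dualPasch (h : IsClassicalGeometry G 𝓒 b α β r) (hα : 0 < α) (hb : 0 ≤ b)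
    (hβ : (r - α - 1) * α * b + α < β) (hr : 3 * b < r) : DualPasch G 𝓒 := by
  classical
  intro x y hxy L hL hx hy z hz z' hz' hne
  by_contra hadj
  set N := (G.neighborFinset x ∩ G.neighborFinset y) \ L with hN
  have hcoe : ∀ w, w ∈ G.commonNeighbors x y \ (L : Set V) → w ∈ N := fun w hw => by
    simpa [hN, SimpleGraph.mem_commonNeighbors] using hw
  replace hz := hcoe z hz
  replace hz' := hcoe z' hz'
  have hmem : ∀ w ∈ N, G.Adj x w ∧ G.Adj y w ∧ w ∉ L := fun w hw => by
    simpa [hN, and_assoc] using hw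
  have hzz' : G.dist z z' = 2 :=
    h.dist_eq_two (hmem z hz).1.symm (SimpleGraph.dist_eq_one_iff_adj.2 (hmem z' hz').1).le hne hadj
  have hnear : ∀ w ∈ N, ((linesNear G 𝓒 w L).card : ℝ) = 1 + b := fun w hw =>
    h.card_linesNear hα.le hb hβ hL (hmem w hw).2.2 ⟨x, hx, (hmem w hw).1.symm⟩
  have h1 := h.card_mul_le_of_far hα.le hb hβ hL hx hy hz'
    (R := linesThrough 𝓒 z' \ linesNear G 𝓒 z' L) subset_rfl
    (S := N.filter fun w => G.Adj z' w)
    (fun w hw M hM hwM hwz => Finset.mem_filter.2 ⟨hw, by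
      obtain ⟨hMC, hzM⟩ := mem_linesThrough.1 (Finset.mem_sdiff.1 hM).1
      exact h.isClique M hMC hzM hwM hwz.symm⟩)
    (fun w hw => (Finset.mem_filter.1 hw).2)
  rw [Finset.cast_card_sdiff linesNear_subset_linesThrough, h.card_lines, hnear z' hz'] at h1
  -- Discarding also the lines through `z` that meet the neighbourhood of `z'` makes this set of
  -- neighbours disjoint from the one counted in `h1`.
  have h2 := h.card_mul_le_of_far hα.le hb hβ hL hx hy hz
    (R := linesThrough 𝓒 z \ (linesNear G 𝓒 z L ∪ linesMeetingNeighbors G 𝓒 z z'))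
    (Finset.sdiff_subset_sdiff subset_rfl Finset.subset_union_left)
    (S := N.filter fun w => G.Adj z w ∧ ¬ G.Adj z' w)
    (fun w hw M hM hwM hwz => by
      rw [Finset.mem_sdiff, Finset.mem_union, not_or] at hM
      obtain ⟨hMC, hzM⟩ := mem_linesThrough.1 hM.1
      exact Finset.mem_filter.2 ⟨hw, h.isClique M hMC hzM hwM hwz.symm, fun hadj' =>
        hM.2.2 (mem_linesMeetingNeighbors.2 ⟨⟨hMC, hzM⟩, w, hwM, hadj'⟩)⟩)
    (fun w hw => (Finset.mem_filter.1 hw).2.1)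
  rw [Finset.cast_card_sdiff (Finset.union_subset linesNear_subset_linesThrough
    linesMeetingNeighbors_subset), h.card_lines] at h2
  -- Two families of `1 + b` lines share the lines `zx` and `zy`: `2(1 + b) - 2 = 2b`.
  have h3 : ((linesNear G 𝓒 z L ∪ linesMeetingNeighbors G 𝓒 z z').card : ℝ) ≤ 2 * b := by
    have h4 : ((linesNear G 𝓒 z L ∪ linesMeetingNeighbors G 𝓒 z z').card : ℝ) +
        (linesNear G 𝓒 z L ∩ linesMeetingNeighbors G 𝓒 z z').card =
        (linesNear G 𝓒 z L).card + (linesMeetingNeighbors G 𝓒 z z').card := by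
      exact_mod_cast Finset.card_union_add_card_inter _ _
    rw [hnear z hz, h.card_linesMeetingNeighbors hα.le hzz'] at h4
    have h5 : (2 : ℝ) ≤ (linesNear G 𝓒 z L ∩ linesMeetingNeighbors G 𝓒 z z').card := by
      exact_mod_cast h.two_le_card_inter hxy hL hx hy hz hz'
    linarith
  have h6 : ((N.filter fun w => G.Adj z' w).card : ℝ) +
      (N.filter fun w => G.Adj z w ∧ ¬ G.Adj z' w).card ≤ (r - 1) * α := by
    rw [← h.card_common_sdiff hxy hL hx hy, ← Nat.cast_add, Nat.cast_le,
      ← Finset.card_union_of_disjoint]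
    · exact Finset.card_le_card (Finset.union_subset (Finset.filter_subset _ _)
        (Finset.filter_subset _ _))
    · rw [Finset.disjoint_filter]
      exact fun w _ h1 h2 => h2.2 h1
  have h7 : (r - 2 * b) * α ≤
      (r - (linesNear G 𝓒 z L ∪ linesMeetingNeighbors G 𝓒 z z').card) * α := by gcongr
  have h8 : (r - 3 * b) * α ≤ 0 := by linarith
  have h9 : 0 < (r - 3 * b) * α := mul_pos (by linarith) hα
  linarith

end CommonNeighbors

end IsClassicalGeometry

end

end DistReg

/-! ### The numerical conditions and the conclusion. -/

theorem lemma22 {V : Type*} [Fintype V] [DecidableEq V] (G : SimpleGraph V) [DecidableRel G.Adj]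
    (D : ℕ) (b α β r : ℝ)
    (hG : DistReg.IsGeometric G)
    (hcl : DistReg.HasClassicalParameters G D b α β)
    (hb : 2 ≤ b) (hα1 : 1 ≤ α) (hαb : α ≤ b - 1) (hD : 3 ≤ D)
    (𝓒 : Set (Finset V))
    (hDel : ∀ K ∈ 𝓒, DistReg.IsDelsarteClique G K)
    (hPLS : DistReg.IsPartialLinearSpace 𝓒)
    (hpt : G = DistReg.pointGraph 𝓒)
    (hr : r = DistReg.bracket b D)
    (hβ : (r - α - 1) * α * b + α < β) :
    DistReg.DualPasch G 𝓒 := by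
  have hb1 : 1 < b := by linarith
  have hα : 0 < α := by linarith
  have hr1 : r = 1 + b * DistReg.bracket b (D - 1) := by
    rw [hr, ← DistReg.bracket_succ hb1.ne', Nat.sub_add_cancel (by omega)]
  have h2 : 1 + b ≤ DistReg.bracket b (D - 1) := by
    rw [← DistReg.bracket_two hb1.ne']
    exact DistReg.bracket_mono hb1 (by omega)
  have hlt : ∀ i < D, α * DistReg.bracket b i < β := by
    intro i hi
    have h3 : DistReg.bracket b i ≤ DistReg.bracket b (D - 1) :=
      DistReg.bracket_mono hb1 (by omega)
    refine lt_of_le_of_lt (mul_le_mul_of_nonneg_left h3 hα.le) (lt_of_le_of_lt ?_ hβ)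
    -- Since `r - 1 = b[D-1]`, this says `αb ≤ (b² - 1)[D-1] + 1`, which holds by `α ≤ b - 1` and
    -- `[D-1] ≥ 1 + b`.
    have h4 : DistReg.bracket b (D - 1) ≤ (r - α - 1) * b + 1 := by
      rw [hr1]
      nlinarith [mul_nonneg (show 0 ≤ DistReg.bracket b (D - 1) - (1 + b) by linarith)
        (show 0 ≤ b * b - 1 by nlinarith), mul_nonneg (show 0 ≤ b by linarith)
        (show 0 ≤ b - 1 - α by linarith), mul_nonneg (show 0 ≤ b - 2 by linarith) (sq_nonneg b)]
    nlinarith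
  obtain ⟨B, C, h⟩ := hcl.classicalNumbers hb1 hα.le hlt
  have hL : DistReg.IsLineSystem G 𝓒 :=
    { isClique := fun K hK => (hDel K hK).1
      exists_line := fun x y hxy => by
        rw [hpt] at hxy
        exact hxy.2
      eq_of_mem := hPLS.2.2 }
  have hgeo := h.isClassicalGeometry hD hL hDel
  rw [← hr] at hgeo
  -- The last condition is `3b < r`: indeed `r ≥ 1 + b + b²` and `b ≥ 2`.
  exact hgeo.dualPasch hα (by linarith) hβ (by nlinarith)
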